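/- Let $G$ be a finite abelian group and let $k$ be a number field. Then there exists a finite Galois extension $E/k$ with $\operatorname{Gal}(E/k)\cong G$ such that $\Phi(E/k)=a^2+b^2$ for some integers $a,b\ge 0$ (either of which may be $0$). Here $\Phi(E/k)$ is the absolute norm of the (finite) conductor $\mathfrak c(E/k)$, which is the ideal $\prod_v \mathfrak p_v^{n_v}$ of $\mathcal O_k$, where $v$ runs over the finite places of $k$, $\mathfrak p_v$ is the prime ideal of $\mathcal O_k$ at $v$, and $n_v\ge 0$ is the least integer $n$ such that every element of $U_v^{(n)}$ is a norm from $E_w^\times$ to $k_v^\times$. Here $w$ is a place of $E$ above $v$ (the choice does not matter), $U_v^{(0)}=\mathcal O_v^\times$, and $U_v^{(n)}=1+\mathfrak p_v^n\mathcal O_v$ for $n\ge 1$, where $\mathcal O_v$ is the ring of integers of the completion $k_v$. -/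

import Mathlib

open scoped NumberField WithZero

noncomputable section

namespace AbelianConductor

open IsDedekindDomain NumberField

variable (k : Type*) [Field k] [NumberField k]

/-- The group of units of level `n` in the completion `k_v`, as a set: this is `𝒪_v^×` for `n = 0`
and `1 + 𝔭_v ^ n` for `n ≥ 1`. (The valuation has values in `ℤᵐ⁰`, and `𝔭_v ^ n` is the set of
those `x` with `v x ≤ exp (-n)`.) -/
def higherUnits (v : HeightOneSpectrum (𝓞 k)) (n : ℕ) : Set (v.adicCompletion k)ˣ :=
  {u | Valued.v (u : v.adicCompletion k) = 1 ∧
    Valued.v ((u : v.adicCompletion k) - 1) ≤ WithZero.exp (-(n : ℤ))}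

variable (E : Type*) [Field E] [Algebra k E] [FiniteDimensional k E]

/-- A fixed `k`-embedding of `E` into an algebraic closure of `k_v`. -/
def localEmbedding (v : HeightOneSpectrum (𝓞 k)) :
    E →ₐ[k] AlgebraicClosure (v.adicCompletion k) :=
  IsAlgClosed.lift

/-- The local extension `E_w / k_v` given by `E / k` at `v`: the compositum of `k_v` and the image
of `E` in the algebraic closure of `k_v`. If `E / k` is Galois, then the image of `E`, hence this
field, is the same for all `k`-embeddings of `E`; it is the completion of `E` at a place `w`
above `v`. -/
def localExtension (v : HeightOneSpectrum (𝓞 k)) :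
    IntermediateField (v.adicCompletion k) (AlgebraicClosure (v.adicCompletion k)) :=
  IntermediateField.adjoin (v.adicCompletion k) (Set.range (localEmbedding k E v))

/-- The norm group `N_{E_w / k_v}(E_w^×)` in `k_v^×`. For `E / k` abelian, it is the kernel of the
homomorphism from `k_v^×` to `Gal(E / k)` given by the local Artin map. -/
def localNormGroup (v : HeightOneSpectrum (𝓞 k)) : Subgroup (v.adicCompletion k)ˣ :=
  (Units.map (Algebra.norm (v.adicCompletion k) :
    localExtension k E v →* v.adicCompletion k)).range

/-- The exponent of the conductor of `E / k` at `v`: the least `n` such that the units of level `n`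
lie in the local norm group. -/
def conductorExponent (v : HeightOneSpectrum (𝓞 k)) : ℕ :=
  sInf {n : ℕ | higherUnits k v n ⊆ (localNormGroup k E v : Set (v.adicCompletion k)ˣ)}

/-- The conductor of an abelian extension `E / k` of number fields, as an ideal of the ring of
integers of `k`: the product of the local conductors over all finite places. (The exponent is `0`
at every unramified place, so the product is finite.) -/
def conductorIdeal : Ideal (𝓞 k) :=
  ∏ᶠ v : HeightOneSpectrum (𝓞 k), v.asIdeal ^ conductorExponent k E v

/-- The absolute norm `Φ(E / k)` of the conductor. -/
def conductorNorm : ℕ :=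
  Ideal.absNorm (conductorIdeal k E)

end AbelianConductor

end

/-!
The extension `E` is taken inside a cyclotomic extension `k(ζ_m)`, where `m` is a product of distinct
rational primes, all congruent to `1` modulo `4` and larger than the discriminant of `k`.

Since `m` is prime to the discriminant, `k` and `ℚ(ζ_m)` are linearly disjoint over `ℚ`, so the
Galois group of `k(ζ_m) / k` is all of `(ℤ/m)ˣ` (`irreducible_cyclotomic_of_coprime_discr`). By the
infinitude of primes congruent to `1` modulo a given integer, `m` can be chosen so that `(ℤ/m)ˣ` maps
onto `G` (`exists_surjective_units_zmod`), and `E` is the fixed field of the kernel.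

At a prime `v` of `k` that does not divide `m` the extension is unramified, and every unit of `k_v`
is a norm, so the conductor exponent is `0` (`conductorExponent_eq_zero_of_le_adjoin`, which rests on
`exists_unramified_extension_norm`). At a prime `v` that divides `m`, the norm of `v` is a power of a
prime congruent to `1` modulo `4`, hence a sum of two squares. So the norm of the conductor is a
product of sums of two squares, and by Brahmagupta's identity it is one itself.
-/

open Polynomial IsLocalRing

/-! ### Hensel's lemma in unramified algebras over a complete local ring -/

theorem isAdicComplete_of_basis {R M ι : Type*} [CommRing R] [AddCommGroup M] [Module R M]
    [Fintype ι] (b : Module.Basis ι R M) (I : Ideal R) [IsAdicComplete I R] :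
    IsAdicComplete I M := by
  have key : ∀ (n : ℕ) (x y : M), x ≡ y [SMOD (I ^ n • ⊤ : Submodule R M)] →
      ∀ i, b.repr x i ≡ b.repr y i [SMOD (I ^ n • ⊤ : Submodule R R)] := by
    intro n x y h i
    have := SModEq.map h (b.coord i)
    rw [Submodule.map_smul''] at this
    exact this.mono (Submodule.smul_mono le_rfl le_top)
  refine { haus' := fun x hx ↦ ?_, prec' := fun f hf ↦ ?_ }
  · refine b.ext_elem fun i ↦ ?_
    rw [map_zero, Finsupp.zero_apply]
    refine IsHausdorff.haus (I := I) inferInstance _ fun n ↦ ?_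
    simpa using key n x 0 (hx n) i
  · have h : ∀ i, ∃ l : R, ∀ n, b.repr (f n) i ≡ l [SMOD (I ^ n • ⊤ : Submodule R R)] := fun i ↦
      IsPrecomplete.prec (I := I) inferInstance fun {a c} hac ↦ key a _ _ (hf hac) i
    choose l hl using h
    refine ⟨∑ i, l i • b i, fun n ↦ ?_⟩
    rw [SModEq.sub_mem]
    nth_rw 1 [← b.sum_repr (f n)]
    rw [← Finset.sum_sub_distrib]
    refine Submodule.sum_mem _ fun i _ ↦ ?_
    rw [← sub_smul]
    refine Submodule.smul_mem_smul ?_ trivial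
    simpa using SModEq.sub_mem.mp (hl i n)

/-- A finite free algebra over an `I`-adically complete ring is complete for the extended ideal, so
that Hensel's lemma holds in it. -/
theorem isAdicComplete_map_algebraMap {R A : Type*} [CommRing R] [CommRing A] [Algebra R A]
    [Module.Free R A] [Module.Finite R A] (I : Ideal R) [IsAdicComplete I R] :
    IsAdicComplete (I.map (algebraMap R A)) A := by
  rw [IsAdicComplete.map_algebraMap_iff]
  exact isAdicComplete_of_basis (Module.Free.chooseBasis R A) I

section
variable {O : Type*} [CommRing O] [IsLocalRing O]
  {F' : Type*} [Field F'] [Algebra (ResidueField O) F']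

/-- If `g` lifts the minimal polynomial of `γ`, then the reduction map `O[X]/(g) → F'` that sends the
root to `γ` has kernel generated by the maximal ideal of `O`: the algebra `O[X]/(g)` is unramified. -/
theorem ker_lift_residue (g : O[X]) (γ : F')
    (hg : g.map (residue O) = minpoly (ResidueField O) γ)
    (hγ : g.eval₂ ((algebraMap (ResidueField O) F').comp (residue O)) γ = 0) :
    RingHom.ker (AdjoinRoot.lift ((algebraMap (ResidueField O) F').comp (residue O)) γ hγ) =
      (maximalIdeal O).map (algebraMap O (AdjoinRoot g)) := by
  apply le_antisymm
  · intro a ha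
    obtain ⟨p, rfl⟩ := AdjoinRoot.mk_surjective a
    rw [RingHom.mem_ker, AdjoinRoot.lift_mk, ← eval₂_map, ← aeval_def] at ha
    obtain ⟨q', hq'⟩ := minpoly.dvd _ _ ha
    obtain ⟨q, rfl⟩ := map_surjective (residue O) residue_surjective q'
    have h0 : (p - g * q).map (residue O) = 0 := by
      rw [Polynomial.map_sub, Polynomial.map_mul, hg, hq', sub_self]
    have h1 : p - g * q ∈ (maximalIdeal O).map (C : O →+* O[X]) := by
      rw [Ideal.mem_map_C_iff]
      intro n
      rw [← residue_eq_zero_iff, ← coeff_map, h0, coeff_zero]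
    have h2 := Ideal.mem_map_of_mem (AdjoinRoot.mk g) h1
    rw [Ideal.map_map, map_sub, map_mul, AdjoinRoot.mk_self, zero_mul, sub_zero] at h2
    exact h2
  · rw [Ideal.map_le_iff_le_comap]
    intro x hx
    rw [Ideal.mem_comap, RingHom.mem_ker]
    change AdjoinRoot.lift _ _ _ (AdjoinRoot.of g x) = 0
    rw [AdjoinRoot.lift_of, RingHom.comp_apply, (residue_eq_zero_iff x).mpr hx, map_zero]

/-- Hensel's lemma in the unramified algebra `O[X]/(g)`, whose residue field is `F' = F(γ)`, for
polynomials with coefficients in `O` that have a simple root in `F'`. -/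
theorem exists_root_adjoinRoot [IsAdicComplete (maximalIdeal O) O]
    [FiniteDimensional (ResidueField O) F']
    (g : O[X]) (hgm : g.Monic) (γ : F') (htop : IntermediateField.adjoin (ResidueField O) {γ} = ⊤)
    (hg : g.map (residue O) = minpoly (ResidueField O) γ)
    (f : O[X]) (hf : f.Monic) (y : F') (hy : aeval y (f.map (residue O)) = 0)
    (hy' : aeval y (derivative (f.map (residue O))) ≠ 0) :
    ∃ a : AdjoinRoot g, aeval a f = 0 := by
  set r := (algebraMap (ResidueField O) F').comp (residue O) with hr
  have hγ : g.eval₂ r γ = 0 := by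
    rw [hr, ← eval₂_map, ← aeval_def, hg, minpoly.aeval]
  set φ := AdjoinRoot.lift r γ hγ with hφ
  have hker := ker_lift_residue g γ hg hγ
  have hsurj : Function.Surjective φ := by
    intro z
    have hz : z ∈ IntermediateField.adjoin (ResidueField O) {γ} := htop ▸ trivial
    rw [← IntermediateField.mem_toSubalgebra,
      IntermediateField.adjoin_simple_toSubalgebra_of_isAlgebraic
        (Algebra.IsAlgebraic.isAlgebraic γ),
      Algebra.adjoin_singleton_eq_range_aeval] at hz
    obtain ⟨p', rfl⟩ := hz
    obtain ⟨p, rfl⟩ := map_surjective (residue O) residue_surjective p'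
    refine ⟨AdjoinRoot.mk g p, ?_⟩
    rw [hφ, AdjoinRoot.lift_mk, hr, ← eval₂_map]
    rfl
  have : Module.Free O (AdjoinRoot g) := hgm.free_adjoinRoot
  have : Module.Finite O (AdjoinRoot g) := hgm.finite_adjoinRoot
  have := isAdicComplete_map_algebraMap (A := AdjoinRoot g) (maximalIdeal O)
  have hcomp : φ.comp (algebraMap O (AdjoinRoot g)) = r := by
    ext x; exact AdjoinRoot.lift_of hγ
  have hev : ∀ (p : O[X]) (a : AdjoinRoot g),
      φ (eval a (p.map (algebraMap O (AdjoinRoot g)))) = aeval (φ a) (p.map (residue O)) := by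
    intro p a
    rw [aeval_def, eval₂_map, ← hr, ← hcomp, eval_map, hom_eval₂]
  obtain ⟨a₀, rfl⟩ := hsurj y
  obtain ⟨a, ha, -⟩ := HenselianRing.is_henselian
    (I := (maximalIdeal O).map (algebraMap O (AdjoinRoot g)))
    (f.map (algebraMap O (AdjoinRoot g))) (hf.map _) a₀
    (by rw [← hker, RingHom.mem_ker, hev, hy])
    (by
      rw [derivative_map]
      set d := eval a₀ ((derivative f).map (algebraMap O (AdjoinRoot g)))
      have hd : φ d ≠ 0 := by rwa [hev, ← derivative_map]
      obtain ⟨e, he⟩ := hsurj (φ d)⁻¹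
      refine IsUnit.of_mul_eq_one (Ideal.Quotient.mk _ e) ?_
      rw [← map_mul, ← map_one (Ideal.Quotient.mk _), Ideal.Quotient.eq, ← hker, RingHom.mem_ker,
        map_sub, map_mul, map_one, he, mul_inv_cancel₀ hd, sub_self])
  refine ⟨a, ?_⟩
  rwa [IsRoot, eval_map, ← aeval_def] at ha

end

/-- The unramified extension `L / K` with a given residue field `F'`. All that is needed of it is its
degree, and that simple roots in `F'` of monic polynomials over `O` lift to roots in `L`. -/
theorem exists_unramified_extension.{u} (O : Type*) [CommRing O] [IsDomain O] [IsLocalRing O]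
    [IsIntegrallyClosed O] [IsAdicComplete (maximalIdeal O) O]
    (K : Type u) [Field K] [Algebra O K] [IsFractionRing O K]
    (F' : Type*) [Field F'] [Algebra (ResidueField O) F'] [FiniteDimensional (ResidueField O) F']
    [Algebra.IsSeparable (ResidueField O) F'] :
    ∃ (L : Type u) (_ : Field L) (_ : Algebra K L),
      FiniteDimensional K L ∧ Module.finrank K L = Module.finrank (ResidueField O) F' ∧
      ∀ (f : O[X]) (y : F'), f.Monic → aeval y (f.map (residue O)) = 0 →
        aeval y (derivative (f.map (residue O))) ≠ 0 →
        ∃ x : L, aeval x (f.map (algebraMap O K)) = 0 := by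
  obtain ⟨γ, hγ⟩ := Field.exists_primitive_element (ResidueField O) F'
  have hint : IsIntegral (ResidueField O) γ := Algebra.IsIntegral.isIntegral γ
  obtain ⟨g, hg, hdeg, hgm⟩ := lifts_and_natDegree_eq_and_monic
    (f := residue O) (p := minpoly (ResidueField O) γ)
    ((mem_lifts _).mpr (map_surjective _ residue_surjective _)) (minpoly.monic hint)
  have hirr : Irreducible (g.map (algebraMap O K)) :=
    (hgm.irreducible_iff_irreducible_map_fraction_map).mp
      (hgm.irreducible_of_irreducible_map (residue O) g (hg ▸ minpoly.irreducible hint))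
  have := Fact.mk hirr
  let pb := AdjoinRoot.powerBasis hirr.ne_zero
  refine ⟨AdjoinRoot (g.map (algebraMap O K)), inferInstance, inferInstance, pb.finite, ?_, ?_⟩
  · rw [pb.finrank, AdjoinRoot.powerBasis_dim, hgm.natDegree_map, hdeg,
      ← IntermediateField.adjoin.finrank hint, hγ, IntermediateField.finrank_top']
  · intro f y hf hy hy'
    obtain ⟨a, ha⟩ := exists_root_adjoinRoot g hgm γ hγ hg f hf y hy hy'
    let ψ : AdjoinRoot g →+* AdjoinRoot (g.map (algebraMap O K)) :=
      AdjoinRoot.lift ((AdjoinRoot.of _).comp (algebraMap O K)) (AdjoinRoot.root _)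
        (by rw [← eval₂_map, AdjoinRoot.eval₂_root])
    refine ⟨ψ a, ?_⟩
    have hψ : ψ.comp (algebraMap O (AdjoinRoot g)) = (AdjoinRoot.of _).comp (algebraMap O K) := by
      ext x; exact AdjoinRoot.lift_of (by rw [← eval₂_map, AdjoinRoot.eval₂_root])
    rw [aeval_def, eval₂_map]
    change eval₂ ((AdjoinRoot.of _).comp (algebraMap O K)) (ψ a) f = 0
    rw [← hψ, ← hom_eval₂, ← aeval_def, ha, map_zero]

theorem Algebra.norm_eq_of_root_of_irreducible {K L : Type*} [Field K] [Field L] [Algebra K L]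
    [FiniteDimensional K L] {f : K[X]} (hf : f.Monic) (hirr : Irreducible f)
    (hdeg : f.natDegree = Module.finrank K L) {x : L} (hx : aeval x f = 0) :
    Algebra.norm K x = (-1) ^ f.natDegree * f.coeff 0 := by
  have hint : IsIntegral K x := Algebra.IsIntegral.isIntegral x
  have hmin : minpoly K x = f := (minpoly.eq_of_irreducible_of_monic hirr hx hf).symm
  have h1 : Module.finrank (IntermediateField.adjoin K {x}) L = 1 := by
    have h := Module.finrank_mul_finrank K (IntermediateField.adjoin K {x}) L
    rw [IntermediateField.adjoin.finrank hint, hmin, hdeg] at h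
    exact Nat.eq_of_mul_eq_mul_left Module.finrank_pos (h.trans (mul_one _).symm)
  rw [Algebra.norm_eq_norm_adjoin, h1, pow_one, ← IntermediateField.adjoin.powerBasis_gen hint,
    Algebra.PowerBasis.norm_gen_eq_coeff_zero_minpoly, IntermediateField.adjoin.powerBasis_gen,
    IntermediateField.minpoly_gen, hmin, IntermediateField.adjoin.powerBasis_dim, hmin]

/-- A complete discretely valued field with finite residue field has an unramified extension that
contains the `m`-th roots of unity, for `m` prime to the residue characteristic, and from which every
unit is a norm.

No successive approximation is needed. Let `γ` generate the unit group of the residue field `F'` of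
`L`. Every `c ∈ O` that reduces to the norm of `γ` is, up to sign, the constant term of a lift of the
minimal polynomial of `γ`; a root of that lift in `L` has norm `c`. Since the norm of `γ` generates
the unit group of the residue field, these `c` generate the unit group of `O`. -/
theorem exists_unramified_extension_norm.{u} (O : Type*) [CommRing O] [IsDomain O] [IsLocalRing O]
    [IsIntegrallyClosed O] [IsAdicComplete (maximalIdeal O) O] [Finite (ResidueField O)]
    (K : Type u) [Field K] [Algebra O K] [IsFractionRing O K]
    (m : ℕ) (hm : (m : ResidueField O) ≠ 0) :
    ∃ (L : Type u) (_ : Field L) (_ : Algebra K L), FiniteDimensional K L ∧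
      (∃ ζ : L, IsPrimitiveRoot ζ m) ∧
      ∀ u : Oˣ, ∃ x : L, Algebra.norm K x = algebraMap O K u := by
  let F := ResidueField O
  have hm' : NeZero (m : F) := ⟨hm⟩
  have hm0 : NeZero m := ⟨by rintro rfl; simp at hm⟩
  obtain ⟨F', _, _, _, ζ, hζ⟩ : ∃ (F' : Type _) (_ : Field F') (_ : Algebra F F')
      (_ : FiniteDimensional F F') (ζ : F'), IsPrimitiveRoot ζ m :=
    ⟨CyclotomicField m (ResidueField O), inferInstance, inferInstance,
      IsCyclotomicExtension.finiteDimensional {m} (ResidueField O) _, _,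
      IsCyclotomicExtension.zeta_spec m (ResidueField O) _⟩
  have : Finite F' := Module.finite_of_finite F
  obtain ⟨L, _, _, hfd, hrank, hL⟩ := exists_unramified_extension O K F'
  refine ⟨L, inferInstance, inferInstance, hfd, ?_, ?_⟩
  · have hroot : aeval ζ ((cyclotomic m O).map (residue O)) = 0 := by
      rw [map_cyclotomic, aeval_def, ← eval_map, map_cyclotomic]
      exact hζ.isRoot_cyclotomic (NeZero.pos m)
    obtain ⟨x, hx⟩ := hL (cyclotomic m O) _ (cyclotomic.monic m O) hroot (by
      rw [map_cyclotomic] at hroot ⊢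
      exact (separable_cyclotomic m F).aeval_derivative_ne_zero hroot)
    -- a root of the `m`-th cyclotomic polynomial is a primitive root of unity only if `m ≠ 0` in `L`
    have hmO : (m : O) ≠ 0 := fun h ↦ hm (by rw [← map_natCast (residue O), h, map_zero])
    have hmL : NeZero (m : L) := ⟨by
      rw [← map_natCast (algebraMap K L), ← map_natCast (algebraMap O K)]
      exact (_root_.map_ne_zero _).mpr ((map_ne_zero_iff _ (IsFractionRing.injective O K)).mpr hmO)⟩
    refine ⟨x, ?_⟩
    rwa [map_cyclotomic, aeval_def, ← eval_map, map_cyclotomic, ← IsRoot.def,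
      isRoot_cyclotomic_iff] at hx
  · obtain ⟨γ, hγ⟩ := IsCyclic.exists_generator (α := F'ˣ)
    have htop : IntermediateField.adjoin F {(γ : F')} = ⊤ := by
      rw [eq_top_iff]
      intro z _
      rcases eq_or_ne z 0 with rfl | hz
      · exact zero_mem _
      · obtain ⟨j, hj⟩ := hγ (Units.mk0 z hz)
        have : z = (γ : F') ^ j := by rw [← Units.val_zpow_eq_zpow_val]; exact congrArg Units.val hj.symm
        rw [this]
        exact zpow_mem (IntermediateField.mem_adjoin_simple_self F _) j
    have hint : IsIntegral F (γ : F') := Algebra.IsIntegral.isIntegral _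
    have hdeg : (minpoly F (γ : F')).natDegree = Module.finrank F F' := by
      rw [← IntermediateField.adjoin.finrank hint, htop, IntermediateField.finrank_top']
    have hpos : 0 < Module.finrank F F' := Module.finrank_pos
    have hnorm : Algebra.norm F (γ : F') =
        (-1) ^ Module.finrank F F' * (minpoly F (γ : F')).coeff 0 := by
      rw [Algebra.norm_eq_of_root_of_irreducible (minpoly.monic hint) (minpoly.irreducible hint)
        hdeg (minpoly.aeval _ _), hdeg]
    -- elements of `O` that reduce to the norm of `γ` are norms
    have key : ∀ c : O, residue O c = Algebra.norm F (γ : F') →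
        ∃ x : L, Algebra.norm K x = algebraMap O K c := by
      intro c hc
      obtain ⟨g, hg, hgd, hgm⟩ := lifts_and_natDegree_eq_and_monic
        (f := residue O) (p := minpoly F (γ : F'))
        ((mem_lifts _).mpr (map_surjective _ residue_surjective _)) (minpoly.monic hint)
      -- correct the constant term of a lift `g` of `minpoly F γ` so that a root has norm `c`
      let d : O := (-1) ^ Module.finrank F F' * c - g.coeff 0
      have hd : residue O d = 0 := by
        have : residue O (g.coeff 0) = (minpoly F (γ : F')).coeff 0 := by rw [← hg, coeff_map]
        rw [map_sub, map_mul, map_pow, map_neg, map_one, hc, hnorm, this, ← mul_assoc, ← mul_pow]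
        simp
      have hgd' : g.natDegree = Module.finrank F F' := hgd.trans hdeg
      have hlt : (C d).degree < g.degree :=
        degree_C_le.trans_lt (natDegree_pos_iff_degree_pos.mp (hgd' ▸ hpos))
      have hhm : (g + C d).Monic := hgm.add_of_left hlt
      have hhd : (g + C d).natDegree = Module.finrank F F' := by
        rw [natDegree_add_C, hgd']
      have hhr : (g + C d).map (residue O) = minpoly F (γ : F') := by
        rw [Polynomial.map_add, map_C, hd, C_0, add_zero, hg]
      have hirr : Irreducible ((g + C d).map (algebraMap O K)) :=
        (hhm.irreducible_iff_irreducible_map_fraction_map).mp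
          (hhm.irreducible_of_irreducible_map (residue O) _ (hhr ▸ minpoly.irreducible hint))
      obtain ⟨x, hx⟩ := hL (g + C d) γ hhm (by rw [hhr, minpoly.aeval]) (by
        rw [hhr]
        exact (Algebra.IsSeparable.isSeparable F (γ : F')).aeval_derivative_ne_zero
          (minpoly.aeval _ _))
      refine ⟨x, ?_⟩
      rw [Algebra.norm_eq_of_root_of_irreducible (hhm.map _) hirr
        (by rw [hhm.natDegree_map, hhd, hrank]) hx, hhm.natDegree_map, hhd, coeff_map, coeff_add,
        coeff_C_zero, add_sub_cancel, map_mul, ← mul_assoc, map_pow, map_neg, map_one, ← mul_pow]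
      simp
    intro u
    -- the norm of `γ` generates the unit group of the residue field
    obtain ⟨c, hc⟩ := residue_surjective (Algebra.norm F (γ : F'))
    have hcu : IsUnit c := by
      rw [← residue_ne_zero_iff_isUnit, hc]
      exact Algebra.norm_ne_zero_iff.mpr γ.ne_zero
    obtain ⟨c, rfl⟩ := hcu
    have hN : ∃ j : ℕ, residue O ((u * c⁻¹ : Oˣ) : O) = residue O (c : O) ^ j := by
      obtain ⟨y, hy⟩ := FiniteField.unitsMap_norm_surjective F F'
        (Units.map (residue O).toMonoidHom (u * c⁻¹))
      obtain ⟨j, hj⟩ := (mem_powers_iff_mem_zpowers).mpr (hγ y)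
      refine ⟨j, ?_⟩
      have := congrArg Units.val hy
      rw [hc, ← map_pow, ← Units.val_pow_eq_pow_val]
      rw [← (show γ ^ j = y from hj)] at this
      exact this.symm
    obtain ⟨j, hj⟩ := hN
    have hcj : (c : O) ^ j * ((c⁻¹ ^ j : Oˣ) : O) = 1 := by
      rw [← Units.val_pow_eq_pow_val, ← Units.val_mul, ← mul_pow, mul_inv_cancel, one_pow,
        Units.val_one]
    obtain ⟨x, hx⟩ := key c hc
    -- `u = (u * c ^ (-j)) * c ^ j`, where `u * c ^ (-j)` reduces to the norm of `γ`
    obtain ⟨y, hy⟩ := key ((u * c⁻¹ : Oˣ) * c * (c⁻¹ ^ j : Oˣ)) (by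
      rw [← hc, map_mul, map_mul, hj, mul_right_comm, ← map_pow, ← map_mul, hcj, map_one, one_mul])
    refine ⟨y * x ^ j, ?_⟩
    rw [map_mul, map_pow, hx, hy, ← map_pow, ← map_mul, mul_assoc, mul_comm _ ((c : O) ^ j), hcj,
      mul_one, ← Units.val_mul, inv_mul_cancel_right]

/-! ### The ring of integers of the completion at a prime -/

open IsDedekindDomain NumberField WithZero IntermediateField

section
variable {R : Type*} [CommRing R] [IsDedekindDomain R] {K : Type*} [Field K] [Algebra R K]
  [IsFractionRing R K] (v : HeightOneSpectrum R)

open MonoidWithZeroHom in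
theorem isAdic_maximalIdeal_adicCompletionIntegers :
    IsAdic (maximalIdeal (v.adicCompletionIntegers K)) := by
  obtain ⟨ϖ, hϖ⟩ := IsDiscreteValuationRing.exists_irreducible (v.adicCompletionIntegers K)
  have hmem : ∀ (n : ℕ) (x : v.adicCompletionIntegers K),
      x ∈ maximalIdeal (v.adicCompletionIntegers K) ^ n ↔
        Valued.v (x : v.adicCompletion K) ≤ Valued.v ((ϖ : v.adicCompletion K) ^ n) := by
    intro n x
    rw [hϖ.maximalIdeal_eq, Ideal.span_singleton_pow, Ideal.mem_span_singleton,
      (HeightOneSpectrum.adicCompletionIntegers.integers K v).dvd_iff_le]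
    rfl
  have hϖ0 : (ϖ : v.adicCompletion K) ≠ 0 := fun h ↦ hϖ.ne_zero (Subtype.ext h)
  have : IsTopologicalRing (v.adicCompletionIntegers K) :=
    inferInstanceAs (IsTopologicalRing (v.adicCompletionIntegers K).toSubring)
  rw [isAdic_iff]
  refine ⟨fun n ↦ ?_, fun s hs ↦ ?_⟩
  · have := (Valued.isOpen_closedBall (v.adicCompletion K)
      (r := Valued.v.restrict ((ϖ : v.adicCompletion K) ^ n)) (by simp [hϖ0])).preimage
      (continuous_subtype_val (p := (· ∈ v.adicCompletionIntegers K)))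
    convert this using 1
    ext x
    simp only [SetLike.mem_coe, hmem, Set.mem_preimage, Set.mem_ofPred_eq,
      Valuation.restrict_le_iff]
  · rw [nhds_subtype_eq_comap, Filter.mem_comap] at hs
    obtain ⟨t, ht, hts⟩ := hs
    obtain ⟨γ, hγ⟩ := Valued.mem_nhds_zero.mp ht
    have hlt : Valued.v (ϖ : v.adicCompletion K) < 1 :=
      Valuation.integer.v_irreducible_lt_one hϖ
    obtain ⟨n, hn⟩ := exists_pow_lt₀ hlt (Units.map (ValueGroup₀.embedding).toMonoidHom γ)
    refine ⟨n, fun x hx ↦ hts (hγ ?_)⟩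
    rw [SetLike.mem_coe, hmem, map_pow] at hx
    exact (Valuation.restrict_lt_iff_lt_embedding _).mpr (hx.trans_lt hn)

instance isAdicComplete_adicCompletionIntegers :
    IsAdicComplete (maximalIdeal (v.adicCompletionIntegers K)) (v.adicCompletionIntegers K) := by
  have : IsUniformAddGroup (v.adicCompletionIntegers K) :=
    (v.adicCompletionIntegers K).toSubring.toAddSubgroup.isUniformAddGroup
  rw [(isAdic_maximalIdeal_adicCompletionIntegers v).isAdicComplete_iff]
  exact ⟨(Valued.isClosed_valuationSubring (v.adicCompletion K)).completeSpace_coe, inferInstance⟩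

/-- The residue field of the completion at `v` is a quotient of `R / v`, as `K` is dense in the
completion. -/
theorem finite_residueField_adicCompletionIntegers [Finite (R ⧸ v.asIdeal)] :
    Finite (ResidueField (v.adicCompletionIntegers K)) := by
  let f : R →+* ResidueField (v.adicCompletionIntegers K) :=
    (residue _).comp (algebraMap R (v.adicCompletionIntegers K))
  have hf : ∀ r ∈ v.asIdeal, f r = 0 := by
    intro r hr
    change residue _ _ = 0
    rw [residue_eq_zero_iff, mem_maximalIdeal, mem_nonunits_iff,
      HeightOneSpectrum.adicCompletionIntegers.isUnit_iff_valued_eq_one]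
    refine ne_of_lt ?_
    change Valued.v ((algebraMap R K r : K) : v.adicCompletion K) < 1
    rw [HeightOneSpectrum.valuedAdicCompletion_eq_valuation']
    exact (v.valuation_lt_one_iff_mem r).mpr hr
  refine Finite.of_surjective (Ideal.Quotient.lift v.asIdeal f hf)
    (Ideal.Quotient.lift_surjective_of_surjective _ hf fun z ↦ ?_)
  obtain ⟨x, rfl⟩ := residue_surjective z
  have hopen : IsOpen {y : v.adicCompletion K | Valued.v (y - x) < 1} := by
    have h := (Valued.isOpen_ball (v.adicCompletion K) 1).preimage
      (continuous_id.sub (continuous_const (y := (x : v.adicCompletion K))))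
    simpa only [Set.preimage_ofPred_eq, Valuation.restrict_lt_one_iff, Pi.sub_apply, id] using h
  obtain ⟨a, ha⟩ := (HeightOneSpectrum.denseRange_algebraMap (K := K) v).exists_mem_open hopen
    ⟨x, by simp⟩
  have ha1 : v.valuation K a ≤ 1 := by
    rw [← HeightOneSpectrum.valuedAdicCompletion_eq_valuation']
    have := Valued.v.map_add ((a : v.adicCompletion K) - x) x
    rw [sub_add_cancel] at this
    exact this.trans (max_le (le_of_lt ha) x.2)
  obtain ⟨r, hr⟩ := v.exists_valuation_sub_lt_of_integer ha1 1
  refine ⟨r, ?_⟩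
  change residue _ _ = residue _ _
  rw [← sub_eq_zero, ← map_sub, residue_eq_zero_iff, mem_maximalIdeal, mem_nonunits_iff,
    HeightOneSpectrum.adicCompletionIntegers.isUnit_iff_valued_eq_one]
  refine ne_of_lt ?_
  change Valued.v (((algebraMap R K r : K) : v.adicCompletion K) - x) < 1
  rw [← sub_add_sub_cancel _ (a : v.adicCompletion K) (x : v.adicCompletion K)]
  refine Valued.v.map_add_lt ?_ ha
  have h : ((algebraMap R K r - a : K) : v.adicCompletion K) =
      ((algebraMap R K r : K) : v.adicCompletion K) - (a : v.adicCompletion K) :=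
    map_sub (algebraMap K (v.adicCompletion K)) _ _
  rw [← h, HeightOneSpectrum.valuedAdicCompletion_eq_valuation']
  simpa using hr

theorem natCast_residueField_ne_zero {m : ℕ} (hm : (m : R) ∉ v.asIdeal) :
    (m : ResidueField (v.adicCompletionIntegers K)) ≠ 0 := by
  rw [← map_natCast (residue _), Ne, residue_eq_zero_iff, mem_maximalIdeal, mem_nonunits_iff,
    HeightOneSpectrum.adicCompletionIntegers.isUnit_iff_valued_eq_one, not_not]
  have h : ((m : v.adicCompletionIntegers K) : v.adicCompletion K) =
      ((algebraMap R K m : K) : v.adicCompletion K) := by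
    change _ = algebraMap K (v.adicCompletion K) _
    simp
  rw [h, HeightOneSpectrum.valuedAdicCompletion_eq_valuation']
  refine le_antisymm (v.valuation_le_one _) (not_lt.mp ?_)
  rwa [v.valuation_lt_one_iff_mem]

end

/-! ### Cyclotomic fields over a number field and quotients of their Galois groups -/

/-- If `m` is prime to the discriminant of `k`, then `k` and `ℚ(ζ_m)` have coprime discriminants, so
they are linearly disjoint over `ℚ` and `ζ_m` has the same degree over `k` as over `ℚ`. -/
theorem irreducible_cyclotomic_of_coprime_discr (k : Type*) [Field k] [NumberField k] (m : ℕ)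
    [NeZero m] (hm : m.Coprime (discr k).natAbs) : Irreducible (cyclotomic m k) := by
  let L := CyclotomicField m k
  have : IsCyclotomicExtension {m} k L := CyclotomicField.isCyclotomicExtension m k
  have : NumberField L := IsCyclotomicExtension.numberField {m} k L
  obtain ⟨ζ, hζ⟩ : ∃ ζ : L, IsPrimitiveRoot ζ m := ⟨_, IsCyclotomicExtension.zeta_spec m k L⟩
  have hcyc : IsCyclotomicExtension {m} ℚ ℚ⟮ζ⟯ :=
    hζ.intermediateField_adjoin_isCyclotomicExtension ℚ
  have : IsGalois ℚ ℚ⟮ζ⟯ := IsCyclotomicExtension.isGalois {m} ℚ _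
  let k' : IntermediateField ℚ L := (IsScalarTower.toAlgHom ℚ k L).fieldRange
  have hk' : discr k' = discr k :=
    (discr_eq_discr_of_algEquiv k (AlgEquiv.ofInjectiveField (IsScalarTower.toAlgHom ℚ k L))).symm
  have hcop : IsCoprime (discr ℚ⟮ζ⟯) (discr k') := by
    rw [Int.isCoprime_iff_nat_coprime, IsCyclotomicExtension.Rat.natAbs_discr m, hk']
    exact Nat.Coprime.coprime_div_left (Nat.Coprime.pow_left _ hm)
      (Nat.prod_primeFactors_pow_totient_ediv_dvd (NeZero.pos m))
  have hdisj : (ℚ⟮ζ⟯).LinearDisjoint k :=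
    linearDisjoint_iff'.mp (linearDisjoint_of_isGalois_isCoprime_discr L ℚ⟮ζ⟯ k' hcop)
  have htop : adjoin k (ℚ⟮ζ⟯ : Set L) = k⟮ζ⟯ := by
    refine le_antisymm (adjoin_le_iff.mpr ?_) (adjoin_simple_le_iff.mpr
      (subset_adjoin k _ (mem_adjoin_simple_self ℚ ζ)))
    have h : ℚ⟮ζ⟯ ≤ (k⟮ζ⟯).restrictScalars ℚ :=
      adjoin_simple_le_iff.mpr (mem_adjoin_simple_self k ζ)
    exact h
  have hint : IsIntegral k ζ := Algebra.IsIntegral.isIntegral ζ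
  have hdeg : (minpoly k ζ).natDegree = m.totient := by
    rw [← adjoin.finrank hint, ← htop, Module.finrank,
      hdisj.adjoin_rank_eq_rank_left_of_isAlgebraic_left, ← Module.finrank,
      IsCyclotomicExtension.Rat.finrank m]
  have hroot : aeval ζ (cyclotomic m k) = 0 := by
    rw [aeval_def, ← eval_map, map_cyclotomic]
    exact hζ.isRoot_cyclotomic (NeZero.pos m)
  rw [eq_of_monic_of_dvd_of_natDegree_le (minpoly.monic hint) (cyclotomic.monic m k)
    (minpoly.dvd k ζ hroot) (by rw [natDegree_cyclotomic, hdeg])]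
  exact minpoly.irreducible hint

theorem exists_surjective_units_zmod_prime {p n : ℕ} [Fact p.Prime] (h : n ∣ p - 1) :
    ∃ f : (ZMod p)ˣ →* Multiplicative (ZMod n), Function.Surjective f := by
  have hcard : Nat.card (ZMod p)ˣ = p - 1 := by
    rw [Nat.card_eq_fintype_card, ZMod.card_units]
  have e := zmodCyclicMulEquiv (inferInstance : IsCyclic (ZMod p)ˣ)
  rw [hcard] at e
  exact ⟨(AddMonoidHom.toMultiplicative (ZMod.castHom h (ZMod n)).toAddMonoidHom).comp
    e.symm.toMonoidHom, (ZMod.castHom_surjective h).comp e.symm.surjective⟩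

theorem exists_injective_prime_modEq_one (ι : Type*) [Finite ι] {d : ℕ} (hd : d ≠ 0) (N : ℕ) :
    ∃ p : ι → ℕ, Function.Injective p ∧ ∀ i, (p i).Prime ∧ N < p i ∧ p i ≡ 1 [MOD d] := by
  have hinf : {p : ℕ | p.Prime ∧ N < p ∧ p ≡ 1 [MOD d]}.Infinite :=
    Set.infinite_of_forall_exists_gt fun a ↦ by
      obtain ⟨p, hp, hlt, hmod⟩ := Nat.exists_prime_gt_modEq_one (max a N) hd
      exact ⟨p, ⟨hp, (le_max_right _ _).trans_lt hlt, hmod⟩, (le_max_left _ _).trans_lt hlt⟩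
  let g := (Finite.equivFin ι).toEmbedding.trans (Fin.valEmbedding.trans hinf.natEmbedding)
  exact ⟨fun i ↦ g i, Subtype.val_injective.comp g.injective, fun i ↦ (g i).2⟩

/-- A finite abelian group is a quotient of `(ℤ/m)ˣ` for a product `m` of distinct arbitrarily large
primes that are `1` modulo `4`: with `G ≅ ∏ ℤ/nᵢ`, take one prime `pᵢ ≡ 1` modulo `4 ∏ nᵢ` for each
`i`. -/
theorem exists_surjective_units_zmod (G : Type*) [CommGroup G] [Finite G] (N : ℕ) :
    ∃ m : ℕ, m ≠ 0 ∧ (∀ p, p.Prime → p ∣ m → N < p ∧ p % 4 = 1) ∧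
      ∃ f : (ZMod m)ˣ →* G, Function.Surjective f := by
  obtain ⟨ι, _, n, hn, ⟨e⟩⟩ := CommGroup.equiv_prod_multiplicative_zmod_of_finite G
  obtain ⟨p, hinj, hp⟩ := exists_injective_prime_modEq_one ι (d := 4 * ∏ i, n i) (mul_ne_zero four_ne_zero
    (Finset.prod_ne_zero_iff.mpr fun i _ ↦ (zero_lt_one.trans (hn i)).ne')) N
  have hcop : Pairwise (Function.onFun Nat.Coprime p) := fun i j hij ↦
    (Nat.coprime_primes (hp i).1 (hp j).1).mpr (hinj.ne hij)
  have hf : ∀ i, ∃ f : (ZMod (p i))ˣ →* Multiplicative (ZMod (n i)), Function.Surjective f := by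
    intro i
    have := Fact.mk (hp i).1
    exact exists_surjective_units_zmod_prime
      (((Finset.dvd_prod_of_mem n (Finset.mem_univ i)).trans (dvd_mul_left _ _)).trans
        ((Nat.modEq_iff_dvd' (hp i).1.one_le).mp (hp i).2.2.symm))
  choose f hf using hf
  refine ⟨∏ i, p i, Finset.prod_ne_zero_iff.mpr fun i _ ↦ (hp i).1.ne_zero, fun q hq hdvd ↦ ?_, ?_⟩
  · obtain ⟨i, -, hi⟩ := (hq.prime.dvd_finsetProd_iff p).mp hdvd
    rw [(Nat.prime_dvd_prime_iff_eq hq (hp i).1).mp hi]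
    exact ⟨(hp i).2.1, (hp i).2.2.of_mul_right _⟩
  · let g := (Units.mapEquiv (ZMod.prodEquivPi p hcop).toMulEquiv).trans MulEquiv.piUnits
    refine ⟨(e.symm.toMonoidHom.comp (MonoidHom.piMap f)).comp g.toMonoidHom, ?_⟩
    exact (e.symm.surjective.comp (Function.Surjective.piMap hf)).comp g.surjective

theorem exists_gal_mulEquiv_of_surjective {k L G : Type*} [Field k] [Field L] [Algebra k L]
    [Group G] (F : IntermediateField k L) [FiniteDimensional k F] [IsGalois k F] (f : Gal(F/k) →* G)
    (hf : Function.Surjective f) :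
    ∃ E : IntermediateField k L, E ≤ F ∧ IsGalois k E ∧ Nonempty (Gal(E/k) ≃* G) := by
  let e := liftAlgEquiv (fixedField f.ker)
  have : IsGalois k (fixedField f.ker) := IsGalois.of_fixedField_normal_subgroup f.ker
  exact ⟨lift (fixedField f.ker), lift_le _, .of_algEquiv e,
    ⟨(AlgEquiv.autCongr e.symm).trans ((IsGalois.normalAutEquivQuotient f.ker).symm.trans
      (QuotientGroup.quotientKerEquivOfSurjective f hf))⟩⟩

/-! ### The conductor -/

namespace AbelianConductor

/-- A subextension of `k(ζ_m)` has conductor exponent `0` at a prime `v` that does not contain `m`: its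
local extension embeds in an unramified extension of `k_v` from which all units are norms, and norms
are transitive. -/
theorem conductorExponent_eq_zero_of_le_adjoin (k : Type*) [Field k] [NumberField k]
    (E : IntermediateField k (AlgebraicClosure k)) [FiniteDimensional k E]
    {ζ : AlgebraicClosure k} {m : ℕ} (hζ : ζ ^ m = 1) (hE : E ≤ k⟮ζ⟯)
    (v : HeightOneSpectrum (𝓞 k)) (hm : (m : 𝓞 k) ∉ v.asIdeal) :
    conductorExponent k E v = 0 := by
  let K := v.adicCompletion k
  let O := v.adicCompletionIntegers k
  let Ω := AlgebraicClosure (v.adicCompletion k)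
  have := finite_residueField_adicCompletionIntegers (K := k) v
  obtain ⟨L, _, _, hfd, ⟨ξ, hξ⟩, hnorm⟩ := exists_unramified_extension_norm O K m
    (natCast_residueField_ne_zero v hm)
  -- extend the fixed embedding of `E` to the algebraic closure of `k`, to see the image of `ζ`
  obtain ⟨ι, hι⟩ : ∃ ι : AlgebraicClosure k →ₐ[k] Ω, ∀ e : E, ι e = localEmbedding k E v e := by
    let := (localEmbedding k E v).toRingHom.toAlgebra
    have : IsScalarTower k E Ω := .of_algebraMap_eq fun x ↦ ((localEmbedding k E v).commutes x).symm
    exact ⟨(IsAlgClosed.lift : AlgebraicClosure k →ₐ[E] Ω).restrictScalars k,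
      fun e ↦ (IsAlgClosed.lift : AlgebraicClosure k →ₐ[E] Ω).commutes e⟩
  have hm0 : m ≠ 0 := by rintro rfl; simp at hm
  have hle : localExtension k E v ≤ IntermediateField.adjoin K {ι ζ} := by
    refine adjoin_le_iff.mpr ?_
    rintro _ ⟨e, rfl⟩
    rw [← hι]
    have h : k⟮ζ⟯ ≤ ((IntermediateField.adjoin K {ι ζ}).restrictScalars k).comap ι := by
      refine adjoin_le_iff.mpr (Set.singleton_subset_iff.mpr ?_)
      exact mem_adjoin_simple_self K (ι ζ)
    exact h (hE e.2)
  have hι1 : aeval (ι ζ) (X ^ m - C 1 : K[X]) = 0 := by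
    rw [map_sub, map_pow, aeval_X, C_1, map_one, ← map_pow ι, hζ, map_one, sub_self]
  have hmonic : (X ^ m - C 1 : K[X]).Monic := monic_X_pow_sub_C 1 hm0
  obtain ⟨φ⟩ : Nonempty (IntermediateField.adjoin K {ι ζ} →ₐ[K] L) := by
    refine nonempty_algHom_adjoin_of_splits fun s hs ↦ ?_
    rw [Set.mem_singleton_iff.mp hs]
    refine ⟨⟨_, hmonic, hι1⟩, (X_pow_sub_one_splits hξ).of_dvd 
      (X_pow_sub_C_ne_zero (Nat.pos_of_ne_zero hm0) 1) ?_⟩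
    have := Polynomial.map_dvd (algebraMap K L) (minpoly.dvd K (ι ζ) hι1)
    simpa using this
  let ψ : localExtension k E v →ₐ[K] L := φ.comp (inclusion hle)
  let := ψ.toRingHom.toAlgebra
  have : IsScalarTower K (localExtension k E v) L :=
    .of_algebraMap_eq fun x ↦ (ψ.commutes x).symm
  refine Nat.sInf_eq_zero.mpr (Or.inl ?_)
  rintro u ⟨hu, -⟩
  obtain ⟨u', hu'⟩ := (HeightOneSpectrum.adicCompletionIntegers.isUnit_iff_valued_eq_one
    (a := (⟨u, hu.le⟩ : O))).mpr hu
  obtain ⟨x, hx⟩ := hnorm u'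
  rw [hu'] at hx
  have hN : Algebra.norm K (Algebra.norm (localExtension k E v) x) = (u : K) := by
    rw [Algebra.norm_norm, hx]
    rfl
  have hne : Algebra.norm (localExtension k E v) x ≠ 0 := by
    intro h
    have hx0 : x ≠ 0 := by
      rintro rfl
      exact u.ne_zero (hx.symm.trans Algebra.norm_zero)
    have : FiniteDimensional (localExtension k E v) L := .right K _ L
    exact hx0 (Algebra.norm_eq_zero_iff.mp h)
  exact ⟨Units.mk0 _ hne, Units.ext hN⟩

/-- The norm of `v` is a power of the rational prime under `v`, and that prime divides `m`, so it is
`1` modulo `4`. -/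
theorem absNorm_eq_sq_add_sq {k : Type*} [Field k] [NumberField k] (v : HeightOneSpectrum (𝓞 k))
    {m : ℕ} (hm : ∀ p, p.Prime → p ∣ m → p % 4 = 1) (hmv : (m : 𝓞 k) ∈ v.asIdeal) :
    ∃ a b : ℕ, Ideal.absNorm v.asIdeal = a ^ 2 + b ^ 2 := by
  have := v.isMaximal
  obtain ⟨p, n, -, hpv, hp, hn⟩ := Ideal.exists_prime_and_absNorm_eq_pow v.asIdeal
  have hpm : p ∣ m := by
    by_contra hpm
    obtain ⟨a, b, hab⟩ := Nat.isCoprime_iff_coprime.mpr ((Nat.Prime.coprime_iff_not_dvd hp).mpr hpm)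
    refine v.isPrime.ne_top ((Ideal.eq_top_iff_one _).mpr ?_)
    convert v.asIdeal.add_mem (v.asIdeal.mul_mem_left (a : 𝓞 k) hpv)
      (v.asIdeal.mul_mem_left (b : 𝓞 k) hmv)
    exact_mod_cast congrArg (Int.cast : ℤ → 𝓞 k) hab.symm
  have hp4 := hm p hp hpm
  have := Fact.mk hp
  obtain ⟨a, b, hab⟩ := Nat.Prime.sq_add_sq (p := p) (by lia)
  rw [hn]
  clear hn
  induction n with
  | zero => exact ⟨1, 0, by simp⟩
  | succ n ih =>
    obtain ⟨r, s, hrs⟩ := ih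
    exact pow_succ p n ▸ Nat.sq_add_sq_mul hrs hab.symm

/-- Sums of two squares are closed under products, so only the primes whose norm is not such a sum
matter. At the other primes any value of the exponent will do. -/
theorem conductorNorm_eq_sq_add_sq (k : Type*) [Field k] [NumberField k]
    (E : Type*) [Field E] [Algebra k E] [FiniteDimensional k E]
    (h : ∀ v : HeightOneSpectrum (𝓞 k), conductorExponent k E v = 0 ∨
      ∃ a b : ℕ, Ideal.absNorm v.asIdeal = a ^ 2 + b ^ 2) :
    ∃ a b : ℕ, conductorNorm k E = a ^ 2 + b ^ 2 := by
  let S : Ideal (𝓞 k) → Prop := fun I ↦ ∃ a b : ℕ, Ideal.absNorm I = a ^ 2 + b ^ 2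
  have hone : S 1 := ⟨1, 0, by simp⟩
  have hmul : ∀ I J, S I → S J → S (I * J) := by
    rintro I J ⟨a, b, hI⟩ ⟨c, d, hJ⟩
    obtain ⟨r, s, hrs⟩ := Nat.sq_add_sq_mul hI hJ
    exact ⟨r, s, by rw [map_mul, hrs]⟩
  refine finprod_induction S hone hmul fun v ↦ ?_
  rcases h v with h0 | hv
  · rwa [h0, pow_zero]
  · induction conductorExponent k E v with
    | zero => rwa [pow_zero]
    | succ n ih => exact pow_succ v.asIdeal n ▸ hmul _ _ ih hv

end AbelianConductor

theorem corollary1p2 (k : Type*) [Field k] [NumberField k] (G : Type*) [CommGroup G] [Finite G] :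
    ∃ (E : IntermediateField k (AlgebraicClosure k)) (_ : FiniteDimensional k E),
      IsGalois k E ∧ Nonempty (Gal(E/k) ≃* G) ∧
        ∃ a b : ℕ, AbelianConductor.conductorNorm k E = a ^ 2 + b ^ 2 := by
  obtain ⟨m, hm0, hm, f, hf⟩ := exists_surjective_units_zmod G (discr k).natAbs
  have := NeZero.mk hm0
  -- every prime factor of `m` exceeds `|discr k|`
  have hcop : m.Coprime (discr k).natAbs := Nat.coprime_of_dvd fun p hp hpm hpd ↦
    (Nat.le_of_dvd (Int.natAbs_pos.mpr (discr_ne_zero k)) hpd).not_gt (hm p hp hpm).1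
  have hirr := irreducible_cyclotomic_of_coprime_discr k m hcop
  obtain ⟨ζ, hζ⟩ : ∃ ζ : AlgebraicClosure k, IsPrimitiveRoot ζ m := by
    obtain ⟨ζ, hζ⟩ := IsAlgClosed.exists_root (cyclotomic m (AlgebraicClosure k))
      (degree_cyclotomic_pos m _ (NeZero.pos m)).ne'
    exact ⟨ζ, isRoot_cyclotomic_iff.mp hζ⟩
  have : IsCyclotomicExtension {m} k k⟮ζ⟯ := hζ.intermediateField_adjoin_isCyclotomicExtension k
  have : FiniteDimensional k k⟮ζ⟯ := IsCyclotomicExtension.finiteDimensional {m} k _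
  have : IsGalois k k⟮ζ⟯ := IsCyclotomicExtension.isGalois {m} k _
  let e := IsCyclotomicExtension.autEquivPow k⟮ζ⟯ hirr
  obtain ⟨E, hE, hgal, hG⟩ := exists_gal_mulEquiv_of_surjective k⟮ζ⟯ (f.comp e.toMonoidHom)
    (hf.comp e.surjective)
  have hfd : FiniteDimensional k E :=
    FiniteDimensional.of_injective (inclusion hE).toLinearMap (inclusion hE).injective
  refine ⟨E, hfd, hgal, hG, AbelianConductor.conductorNorm_eq_sq_add_sq k E fun v ↦ ?_⟩
  by_cases hv : (m : 𝓞 k) ∈ v.asIdeal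
  · exact Or.inr (AbelianConductor.absNorm_eq_sq_add_sq v (fun p hp hpm ↦ (hm p hp hpm).2) hv)
  · exact Or.inl (AbelianConductor.conductorExponent_eq_zero_of_le_adjoin k E hζ.pow_eq_one hE v hv)
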